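/- For $k\in[0,1]$ let $\mathrm{sn}(\cdot,k),\mathrm{cn}(\cdot,k),\mathrm{dn}(\cdot,k):\mathbb R\to\mathbb R$ be the Jacobi elliptic functions of modulus $k$, i.e. the unique solution of $\mathrm{sn}'=\mathrm{cn}\,\mathrm{dn}$, $\mathrm{cn}'=-\mathrm{sn}\,\mathrm{dn}$, $\mathrm{dn}'=-k^2\,\mathrm{sn}\,\mathrm{cn}$ with $\mathrm{sn}(0,k)=0$, $\mathrm{cn}(0,k)=\mathrm{dn}(0,k)=1$. Let $w_1,w_2,w_3:\mathbb R\to\mathbb C$ be differentiable functions with $$w_1'=\overline{w_2w_3},\qquad w_2'=-\overline{w_3w_1},\qquad w_3'=-\overline{w_1w_2},$$ such that $w_1,w_2,w_3$ are all nonzero for generic $t$ (it suffices: for some $t$). Then there are unique $\alpha_1,\alpha_2,\alpha_3>0$ with $\frac1{\alpha_1}=\frac1{\alpha_2}+\frac1{\alpha_3}$ for which there is a function $u:\mathbb R\to\mathbb R$ with $|w_1|^2=\alpha_1+u$, $|w_2|^2=\alpha_2-u$, $|w_3|^2=\alpha_3-u$. Write $$w_1=e^{i\theta_1}\sqrt{\alpha_1+u},\qquad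 w_2=e^{i\theta_2}\sqrt{\alpha_2-u},\qquad w_3=e^{i\theta_3}\sqrt{\alpha_3-u},$$ where $\theta_j:\mathbb R\to\mathbb R$ is differentiable at every $t$ with $w_j(t)\ne0$ (its values at zeros of $w_j$ are arbitrary), and let $Q(x)=(\alpha_1+x)(\alpha_2-x)(\alpha_3-x)$. Then $Q(u)^{1/2}\sin(\theta_1+\theta_2+\theta_3)\equiv A$ for some constant $A\in\mathbb R$. Suppose moreover that $u$ has a (local or global) minimum at $t=0$, that $\theta_2(0)=\theta_3(0)=0$, $A\ge0$ and $\alpha_2\le\alpha_3$. Then exactly one of the following four cases holds. (a) $A=0$ and $\alpha_2=\alpha_3$, and $w_1(t)=\sqrt{3\alpha_1}\tanh(t\sqrt{3\alpha_1})$, $w_2(t)=w_3(t)=\sqrt{3\alpha_1}\,\mathrm{sech}(t\sqrt{3\alpha_1})$. (b) $A=0$ and $\alpha_2<\alpha_3$, and $w_1=(\alpha_1+\alpha_2)^{1/2}\mathrm{sn}(\sigma t,\tau)$, $w_2=(\alpha_1+\alpha_2)^{1/2}\mathrm{cn}(\sigma t,\tau)$, $w_3=(\alpha_1+\alpha_3)^{1/2}\mathrm{dn}(\sigma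 t,\tau)$, where $\sigma=(\alpha_1+\alpha_3)^{1/2}$ and $\tau=(\alpha_1+\alpha_2)^{1/2}(\alpha_1+\alpha_3)^{-1/2}$; and $w_1,w_2,w_3$ are periodic in $t$ with a common period $T>0$. (c) $0<A<(\alpha_1\alpha_2\alpha_3)^{1/2}$; the cubic $Q(x)-A^2$ has three real roots (with multiplicity) $\gamma_1\le0\le\gamma_2\le\gamma_3$, and, with $\sigma=(\gamma_3-\gamma_1)^{1/2}$ and $\tau=(\gamma_2-\gamma_1)^{1/2}(\gamma_3-\gamma_1)^{-1/2}$, $$u(t)=\gamma_1+(\gamma_2-\gamma_1)\,\mathrm{sn}^2(\sigma t,\tau),$$ $$\theta_1(t)=\theta_1(0)-A\int_0^t\frac{ds}{\alpha_1+\gamma_1+(\gamma_2-\gamma_1)\,\mathrm{sn}^2(\sigma s,\tau)},$$ $$\theta_j(t)=A\int_0^t\frac{ds}{\alpha_j-\gamma_1-(\gamma_2-\gamma_1)\,\mathrm{sn}^2(\sigma s,\tau)}\qquad(j=2,3).$$ (d) $A=(\alpha_1\alpha_2\alpha_3)^{1/2}$, and with $a_1=-\alpha_1^{-1/2}(\alpha_2\alpha_3)^{1/2}$,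 $a_2=\alpha_2^{-1/2}(\alpha_3\alpha_1)^{1/2}$, $a_3=\alpha_3^{-1/2}(\alpha_1\alpha_2)^{1/2}$ one has $a_1+a_2+a_3=0$ and $w_1(t)=i\sqrt{\alpha_1}\,e^{ia_1t}$, $w_2(t)=\sqrt{\alpha_2}\,e^{ia_2t}$, $w_3(t)=\sqrt{\alpha_3}\,e^{ia_3t}$. -/

import Mathlib

/-! ### Jacobi elliptic functions of a real argument -/

/-- `s`, `c`, `d` are the Jacobi elliptic functions `sn`, `cn`, `dn` with modulus `k`:
they solve `sn' = cn dn`, `cn' = - sn dn`, `dn' = - k² sn cn` on the whole real line,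
with `sn 0 = 0`, `cn 0 = 1`, `dn 0 = 1`. -/
structure IsJacobiTriple (k : ℝ) (s c d : ℝ → ℝ) : Prop where
  deriv_sn : ∀ t, HasDerivAt s (c t * d t) t
  deriv_cn : ∀ t, HasDerivAt c (-(s t * d t)) t
  deriv_dn : ∀ t, HasDerivAt d (-(k ^ 2 * (s t * c t))) t
  sn_zero : s 0 = 0
  cn_zero : c 0 = 1
  dn_zero : d 0 = 1

theorem IsJacobiTriple.sq_add_sq {k : ℝ} {s c d : ℝ → ℝ} (h : IsJacobiTriple k s c d) (t : ℝ) :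
    s t ^ 2 + c t ^ 2 = 1 := by
  have hd : ∀ x, HasDerivAt (fun x => s x ^ 2 + c x ^ 2) 0 x := fun x => by
    refine (((h.deriv_sn x).pow 2).add ((h.deriv_cn x).pow 2)).congr_deriv ?_
    push_cast
    ring
  have := is_const_of_deriv_eq_zero (fun x => (hd x).differentiableAt) (fun x => (hd x).deriv) t 0
  simpa [h.sn_zero, h.cn_zero] using this

theorem IsJacobiTriple.sq_add_dn_sq {k : ℝ} {s c d : ℝ → ℝ} (h : IsJacobiTriple k s c d) (t : ℝ) :
    k ^ 2 * s t ^ 2 + d t ^ 2 = 1 := by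
  have hd : ∀ x, HasDerivAt (fun x => k ^ 2 * s x ^ 2 + d x ^ 2) 0 x := fun x => by
    refine ((((h.deriv_sn x).pow 2).const_mul (k ^ 2)).add ((h.deriv_dn x).pow 2)).congr_deriv ?_
    push_cast
    ring
  have := is_const_of_deriv_eq_zero (fun x => (hd x).differentiableAt) (fun x => (hd x).deriv) t 0
  simpa [h.sn_zero, h.dn_zero] using this

theorem IsJacobiTriple.unique {k : ℝ} {s c d s' c' d' : ℝ → ℝ} (h : IsJacobiTriple k s c d)
    (h' : IsJacobiTriple k s' c' d') : s = s' ∧ c = c' ∧ d = d' := by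
  let v : ℝ × ℝ × ℝ → ℝ × ℝ × ℝ := fun p =>
    (p.2.1 * p.2.2, -(p.1 * p.2.2), -(k ^ 2 * (p.1 * p.2.1)))
  have hv : ContDiff ℝ 1 v := by fun_prop
  obtain ⟨K, hK⟩ := hv.locallyLipschitz.locallyLipschitzOn.exists_lipschitzOnWith_of_compact
    (isCompact_closedBall (0 : ℝ × ℝ × ℝ) 1)
  have key : ∀ {s c d : ℝ → ℝ}, IsJacobiTriple k s c d → ∀ t,
      HasDerivAt (fun t => (s t, c t, d t)) (v (s t, c t, d t)) t ∧
        (s t, c t, d t) ∈ Metric.closedBall (0 : ℝ × ℝ × ℝ) 1 := by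
    intro s c d h t
    refine ⟨(h.deriv_sn t).prodMk ((h.deriv_cn t).prodMk (h.deriv_dn t)), ?_⟩
    have h1 := h.sq_add_sq t
    have h2 := h.sq_add_dn_sq t
    have h3 : |s t| ≤ 1 := by rw [← sq_le_one_iff_abs_le_one]; nlinarith [sq_nonneg (c t)]
    have h4 : |c t| ≤ 1 := by rw [← sq_le_one_iff_abs_le_one]; nlinarith [sq_nonneg (s t)]
    have h5 : |d t| ≤ 1 := by
      rw [← sq_le_one_iff_abs_le_one]; nlinarith [mul_nonneg (sq_nonneg k) (sq_nonneg (s t))]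
    simp [Prod.norm_def, h3, h4, h5]
  have heq := ODE_solution_unique_univ (v := fun _ => v)
    (s := fun _ => Metric.closedBall (0 : ℝ × ℝ × ℝ) 1) (t₀ := 0)
    (f := fun t => (s t, c t, d t)) (g := fun t => (s' t, c' t, d' t))
    (fun _ => hK) (key h) (key h')
    (by simp [h.sn_zero, h.cn_zero, h.dn_zero, h'.sn_zero, h'.cn_zero, h'.dn_zero])
  refine ⟨?_, ?_, ?_⟩ <;> funext t <;> have := congrFun heq t <;> simp_all

theorem exists_isJacobiTriple {k : ℝ} (h0 : 0 ≤ k) (h1 : k ≤ 1) :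
    ∃ f : (ℝ → ℝ) × (ℝ → ℝ) × (ℝ → ℝ), IsJacobiTriple k f.1 f.2.1 f.2.2 := by
  rcases h1.lt_or_eq with hk | rfl
  · have hpos : ∀ x : ℝ, 0 < 1 - k ^ 2 * Real.sin x ^ 2 := fun x => by
      have := Real.sin_sq_le_one x
      nlinarith [sq_nonneg k, sq_nonneg (Real.sin x)]
    let g : ℝ → ℝ := fun x => √(1 - k ^ 2 * Real.sin x ^ 2)
    have hg : ∀ x, 0 < g x := fun x => Real.sqrt_pos.2 (hpos x)
    have hg1 : ∀ x, 1 ≤ (g x)⁻¹ := fun x => by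
      refine (one_le_inv₀ (hg x)).2 (Real.sqrt_le_one.2 ?_)
      nlinarith [mul_nonneg (sq_nonneg k) (sq_nonneg (Real.sin x))]
    have hgc : Continuous g := by fun_prop
    have hgi : Continuous fun x => (g x)⁻¹ := hgc.inv₀ fun x => (hg x).ne'
    let F : ℝ → ℝ := fun x => ∫ y in (0 : ℝ)..x, (g y)⁻¹
    have hF : ∀ x, HasDerivAt F (g x)⁻¹ x := fun x =>
      (hgi.integral_hasStrictDerivAt 0 x).hasDerivAt
    have hF0 : F 0 = 0 := by simp [F]
    have hmono : StrictMono F := strictMono_of_hasDerivAt_pos hF fun x => inv_pos.2 (hg x)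
    have hsub : Monotone fun x => F x - x :=
      monotone_of_hasDerivAt_nonneg (fun x => (hF x).sub (hasDerivAt_id x))
        fun x => sub_nonneg.2 (hg1 x)
    have hsurj : Function.Surjective F := by
      refine Continuous.surjective
        (continuous_iff_continuousAt.2 fun x => (hF x).continuousAt) ?_ ?_
      · refine Filter.tendsto_atTop_mono' _ ?_ Filter.tendsto_id
        filter_upwards [Filter.eventually_ge_atTop 0] with x hx
        have := hsub hx
        simp only [hF0] at this
        simp only [id]
        linarith
      · refine Filter.tendsto_atBot_mono' _ ?_ Filter.tendsto_id
        filter_upwards [Filter.eventually_le_atBot 0] with x hx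
        have := hsub hx
        simp only [hF0] at this
        simp only [id]
        linarith
    let e := hmono.orderIsoOfSurjective F hsurj
    let am : ℝ → ℝ := e.symm
    have hFam : ∀ t, F (am t) = t := fun t => e.apply_symm_apply t
    have ham : ∀ t, HasDerivAt am (g (am t)) t := fun t => by
      have := HasDerivAt.of_local_left_inverse (f := F) (g := am) (a := t)
        e.symm.continuous.continuousAt (hF (am t)) (inv_pos.2 (hg _)).ne'
        (Filter.Eventually.of_forall hFam)
      simpa using this
    have ham0 : am 0 = 0 := hmono.injective (by rw [hFam, hF0])
    refine ⟨(fun t => Real.sin (am t), fun t => Real.cos (am t), fun t => g (am t)),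
      fun t => (ham t).sin, fun t => ?_, fun t => ?_, by simp [ham0], by simp [ham0],
      by simp [ham0, g]⟩
    · exact (ham t).cos.congr_deriv (by ring)
    · have h2 := ((((ham t).sin.pow 2).const_mul (k ^ 2)).const_sub 1).sqrt (hpos _).ne'
      refine h2.congr_deriv ?_
      have hne := (hg (am t)).ne'
      change _ / (2 * g (am t)) = _
      field_simp
      push_cast
      ring
  · have hc : ∀ t : ℝ, Real.cosh t ≠ 0 := fun t => (Real.cosh_pos t).ne'
    have hd : ∀ t, HasDerivAt (fun t => (Real.cosh t)⁻¹)
        (-(Real.tanh t * (Real.cosh t)⁻¹)) t := fun t => by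
      refine ((Real.hasDerivAt_cosh t).inv (hc t)).congr_deriv ?_
      have := hc t
      rw [Real.tanh_eq_sinh_div_cosh]
      field_simp
    refine ⟨(Real.tanh, fun t => (Real.cosh t)⁻¹, fun t => (Real.cosh t)⁻¹),
      fun t => ?_, hd, fun t => by simpa using hd t, by simp, by simp, by simp⟩
    have h2 := (Real.hasDerivAt_sinh t).div (Real.hasDerivAt_cosh t) (hc t)
    have h3 : Real.tanh = Real.sinh / Real.cosh := by
      funext x
      simp [Real.tanh_eq_sinh_div_cosh]
    simp only [h3]
    refine h2.congr_deriv ?_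
    have h4 := Real.cosh_sq t
    have := hc t
    field_simp
    linarith

open Classical in
/-- The triple `(sn(·, k), cn(·, k), dn(·, k))`; for `0 ≤ k ≤ 1` it exists and is
unique, so that the default value `0` plays no role. -/
noncomputable def jacobiTriple (k : ℝ) : (ℝ → ℝ) × (ℝ → ℝ) × (ℝ → ℝ) :=
  if h : ∃ f : (ℝ → ℝ) × (ℝ → ℝ) × (ℝ → ℝ), IsJacobiTriple k f.1 f.2.1 f.2.2 then h.choose else 0

/-- The Jacobi elliptic function `sn(t, k)`. -/
noncomputable def jacobiSn (t k : ℝ) : ℝ := (jacobiTriple k).1 t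

/-- The Jacobi elliptic function `cn(t, k)`. -/
noncomputable def jacobiCn (t k : ℝ) : ℝ := (jacobiTriple k).2.1 t

/-- The Jacobi elliptic function `dn(t, k)`. -/
noncomputable def jacobiDn (t k : ℝ) : ℝ := (jacobiTriple k).2.2 t

theorem isJacobiTriple_jacobi {k : ℝ} (h0 : 0 ≤ k) (h1 : k ≤ 1) :
    IsJacobiTriple k (fun t => jacobiSn t k) (fun t => jacobiCn t k) (fun t => jacobiDn t k) := by
  have h := exists_isJacobiTriple h0 h1
  simp only [jacobiSn, jacobiCn, jacobiDn, jacobiTriple, dif_pos h]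
  exact h.choose_spec

/-! ### The evolution equations and their polar form -/

/-- `w₁, w₂, w₃ : ℝ → ℂ` satisfy `w₁' = conj (w₂ w₃)`, `w₂' = -conj (w₃ w₁)`,
`w₃' = -conj (w₁ w₂)`. -/
structure SolvesEvolution (w₁ w₂ w₃ : ℝ → ℂ) : Prop where
  deriv_one : ∀ t, HasDerivAt w₁ (starRingEnd ℂ (w₂ t * w₃ t)) t
  deriv_two : ∀ t, HasDerivAt w₂ (-starRingEnd ℂ (w₃ t * w₁ t)) t
  deriv_three : ∀ t, HasDerivAt w₃ (-starRingEnd ℂ (w₁ t * w₂ t)) t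

/-- The constants `α₁, α₂, α₃` and the function `u` of a triple `w₁, w₂, w₃`: the `αⱼ` are
positive with `1/α₁ = 1/α₂ + 1/α₃`, and `|w₁|² = α₁ + u`, `|w₂|² = α₂ - u`, `|w₃|² = α₃ - u`. -/
structure IsModuli (w₁ w₂ w₃ : ℝ → ℂ) (α₁ α₂ α₃ : ℝ) (u : ℝ → ℝ) : Prop where
  pos_one : 0 < α₁
  pos_two : 0 < α₂
  pos_three : 0 < α₃
  inv_eq : 1 / α₁ = 1 / α₂ + 1 / α₃
  norm_one : ∀ t, ‖w₁ t‖ ^ 2 = α₁ + u t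
  norm_two : ∀ t, ‖w₂ t‖ ^ 2 = α₂ - u t
  norm_three : ∀ t, ‖w₃ t‖ ^ 2 = α₃ - u t

/-- `θ` is a phase function of `w`, with `w = e^{iθ} √r`, differentiable wherever `w` is nonzero.
Its values at the zeros of `w` are arbitrary, and it may jump there. -/
structure IsPhase (w : ℝ → ℂ) (r θ : ℝ → ℝ) : Prop where
  polar : ∀ t, w t = Complex.exp (Complex.I * (θ t : ℂ)) * (√(r t) : ℂ)
  differentiableAt : ∀ t, w t ≠ 0 → DifferentiableAt ℝ θ t

/-- The polar form `w₁ = e^{iθ₁} √(α₁ + u)`, `w₂ = e^{iθ₂} √(α₂ - u)`,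
`w₃ = e^{iθ₃} √(α₃ - u)`. -/
structure IsPolarForm (w₁ w₂ w₃ : ℝ → ℂ) (α₁ α₂ α₃ : ℝ) (u θ₁ θ₂ θ₃ : ℝ → ℝ) : Prop where
  moduli : IsModuli w₁ w₂ w₃ α₁ α₂ α₃ u
  phase_one : IsPhase w₁ (fun t => α₁ + u t) θ₁
  phase_two : IsPhase w₂ (fun t => α₂ - u t) θ₂
  phase_three : IsPhase w₃ (fun t => α₃ - u t) θ₃

/-- `Q(x) = (α₁ + x)(α₂ - x)(α₃ - x)`. -/
def evolutionQ (α₁ α₂ α₃ x : ℝ) : ℝ := (α₁ + x) * (α₂ - x) * (α₃ - x)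

/-! ### The four cases -/

/-- Case (a): `tanh` and `sech`. -/
def CaseA (w₁ w₂ w₃ : ℝ → ℂ) (α₁ α₂ α₃ A : ℝ) : Prop :=
  A = 0 ∧ α₂ = α₃ ∧ ∀ t : ℝ,
    w₁ t = ((√(3 * α₁) * Real.tanh (t * √(3 * α₁)) : ℝ) : ℂ) ∧
    w₂ t = ((√(3 * α₁) * (Real.cosh (t * √(3 * α₁)))⁻¹ : ℝ) : ℂ) ∧
    w₃ t = ((√(3 * α₁) * (Real.cosh (t * √(3 * α₁)))⁻¹ : ℝ) : ℂ)

/-- Case (b): Jacobi elliptic functions, with periodicity. -/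
def CaseB (w₁ w₂ w₃ : ℝ → ℂ) (α₁ α₂ α₃ A : ℝ) : Prop :=
  A = 0 ∧ α₂ < α₃ ∧
  (∃ σ τ : ℝ, σ = √(α₁ + α₃) ∧ τ = √(α₁ + α₂) / √(α₁ + α₃) ∧ ∀ t : ℝ,
    w₁ t = ((√(α₁ + α₂) * jacobiSn (σ * t) τ : ℝ) : ℂ) ∧
    w₂ t = ((√(α₁ + α₂) * jacobiCn (σ * t) τ : ℝ) : ℂ) ∧
    w₃ t = ((√(α₁ + α₃) * jacobiDn (σ * t) τ : ℝ) : ℂ)) ∧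
  ∃ T : ℝ, 0 < T ∧ Function.Periodic w₁ T ∧ Function.Periodic w₂ T ∧ Function.Periodic w₃ T

/-- Case (c): `u` through `sn²` and the phases as integrals; `γ₁ ≤ 0 ≤ γ₂ ≤ γ₃` are the roots of
`Q - A²`, with multiplicity. -/
def CaseC (α₁ α₂ α₃ A : ℝ) (u θ₁ θ₂ θ₃ : ℝ → ℝ) : Prop :=
  0 < A ∧ A < √(α₁ * α₂ * α₃) ∧
  ∃ γ₁ γ₂ γ₃ : ℝ, γ₁ ≤ 0 ∧ 0 ≤ γ₂ ∧ γ₂ ≤ γ₃ ∧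
    (∀ x : ℝ, evolutionQ α₁ α₂ α₃ x - A ^ 2 = (x - γ₁) * (x - γ₂) * (x - γ₃)) ∧
    ∃ σ τ : ℝ, σ = √(γ₃ - γ₁) ∧ τ = √(γ₂ - γ₁) / √(γ₃ - γ₁) ∧ ∀ t : ℝ,
      u t = γ₁ + (γ₂ - γ₁) * jacobiSn (σ * t) τ ^ 2 ∧
      θ₁ t = θ₁ 0 -
        A * ∫ s in (0 : ℝ)..t, 1 / (α₁ + γ₁ + (γ₂ - γ₁) * jacobiSn (σ * s) τ ^ 2) ∧
      θ₂ t = A * ∫ s in (0 : ℝ)..t, 1 / (α₂ - γ₁ - (γ₂ - γ₁) * jacobiSn (σ * s) τ ^ 2) ∧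
      θ₃ t = A * ∫ s in (0 : ℝ)..t, 1 / (α₃ - γ₁ - (γ₂ - γ₁) * jacobiSn (σ * s) τ ^ 2)

/-- Case (d): exponentials. -/
def CaseD (w₁ w₂ w₃ : ℝ → ℂ) (α₁ α₂ α₃ A : ℝ) : Prop :=
  A = √(α₁ * α₂ * α₃) ∧
  ∃ a₁ a₂ a₃ : ℝ, a₁ = -(√(α₂ * α₃) / √α₁) ∧ a₂ = √(α₃ * α₁) / √α₂ ∧ a₃ = √(α₁ * α₂) / √α₃ ∧
    a₁ + a₂ + a₃ = 0 ∧ ∀ t : ℝ,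
      w₁ t = Complex.I * (√α₁ : ℂ) * Complex.exp (Complex.I * (a₁ : ℂ) * (t : ℂ)) ∧
      w₂ t = (√α₂ : ℂ) * Complex.exp (Complex.I * (a₂ : ℂ) * (t : ℂ)) ∧
      w₃ t = (√α₃ : ℂ) * Complex.exp (Complex.I * (a₃ : ℂ) * (t : ℂ))

/-! The sums |w₁|² + |w₂|² and |w₁|² + |w₃|² and the imaginary part of w₁w₂w₃ are conserved. The two
sums determine the moduli; the imaginary part is A, and |w₁w₂w₃|² = Q(u). Since u' = 2 Re(w₁w₂w₃),
it follows that u'² = 4(Q(u) - A²) and u'' = 2Q'(u).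

The normalisation of the αⱼ says exactly that Q'(0) = 0, so Q(0) - Q(x) = x²(α₂ + α₃ - α₁ - x). At a
minimum u' = 0 and u'' ≥ 0, which gives Q(u(0)) = A² and u(0) ≤ 0 (`nonpos_of_isLocalMin`), hence A
≤ √(α₁α₂α₃). If A = 0, then w₁(0) = 0; at the upper extreme u(0) = 0; in between, u(0) is the lowest
root of Q - A².

In the two extreme cases the initial values of all wⱼ are known, and ODE uniqueness
(`SolvesEvolution.eq_of_eq_zero`) identifies the solution with an explicit one. In between,
uniqueness is applied to the second-order equation for u (`IsModuli.eq_jacobiSn`), and the phases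
are recovered by integrating θⱼ' (`IsPhase.hasDerivAt`). -/

/-! ### Uniqueness of solutions -/

/-- Global solutions of an autonomous equation with a locally Lipschitz right-hand side on a
normed space are determined by their value at `0`. -/
theorem eq_of_hasDerivAt_of_locallyLipschitz {E : Type*} [NormedAddCommGroup E] [NormedSpace ℝ E]
    {v : E → E} (hv : LocallyLipschitz v) {f g : ℝ → E}
    (hf : ∀ t, HasDerivAt f (v (f t)) t) (hg : ∀ t, HasDerivAt g (v (g t)) t)
    (h0 : f 0 = g 0) : f = g := by
  funext t
  have hfc : Continuous f := continuous_iff_continuousAt.2 fun t => (hf t).continuousAt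
  have hgc : Continuous g := continuous_iff_continuousAt.2 fun t => (hg t).continuousAt
  -- Both trajectories over a compact interval around 0 and t stay in one compact set, where a
  -- single Lipschitz constant works.
  let I := Set.Icc (-(|t| + 1)) (|t| + 1)
  have hcomp : IsCompact (f '' I ∪ g '' I) :=
    (isCompact_Icc.image hfc).union (isCompact_Icc.image hgc)
  obtain ⟨K, hK⟩ := hv.locallyLipschitzOn.exists_lipschitzOnWith_of_compact hcomp
  have h1 := neg_abs_le t
  have h2 := le_abs_self t
  have h3 := abs_nonneg t
  exact ODE_solution_unique_of_mem_Ioo (v := fun _ => v) (s := fun _ => f '' I ∪ g '' I)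
    (a := -(|t| + 1)) (b := |t| + 1) (t₀ := 0) (fun _ _ => hK)
    (by constructor <;> linarith)
    (fun s hs => ⟨hf s, Or.inl ⟨s, Set.Ioo_subset_Icc_self hs, rfl⟩⟩)
    (fun s hs => ⟨hg s, Or.inr ⟨s, Set.Ioo_subset_Icc_self hs, rfl⟩⟩) h0
    (by constructor <;> linarith)

theorem SolvesEvolution.eq_of_eq_zero {w₁ w₂ w₃ z₁ z₂ z₃ : ℝ → ℂ} (hw : SolvesEvolution w₁ w₂ w₃)
    (hz : SolvesEvolution z₁ z₂ z₃) (h₁ : w₁ 0 = z₁ 0) (h₂ : w₂ 0 = z₂ 0) (h₃ : w₃ 0 = z₃ 0) :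
    w₁ = z₁ ∧ w₂ = z₂ ∧ w₃ = z₃ := by
  let v : ℂ × ℂ × ℂ → ℂ × ℂ × ℂ := fun p =>
    (Complex.conjCLE (p.2.1 * p.2.2), -Complex.conjCLE (p.2.2 * p.1),
      -Complex.conjCLE (p.1 * p.2.1))
  have hv : ContDiff ℝ 1 v := by fun_prop
  have h := eq_of_hasDerivAt_of_locallyLipschitz hv.locallyLipschitz
    (f := fun t => (w₁ t, w₂ t, w₃ t)) (g := fun t => (z₁ t, z₂ t, z₃ t))
    (fun t => (hw.deriv_one t).prodMk ((hw.deriv_two t).prodMk (hw.deriv_three t)))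
    (fun t => (hz.deriv_one t).prodMk ((hz.deriv_two t).prodMk (hz.deriv_three t)))
    (by simp [h₁, h₂, h₃])
  refine ⟨?_, ?_, ?_⟩ <;> funext t <;> have := congrFun h t <;> simp_all

theorem solvesEvolution_ofReal {x y z : ℝ → ℝ} (hx : ∀ t, HasDerivAt x (y t * z t) t)
    (hy : ∀ t, HasDerivAt y (-(z t * x t)) t) (hz : ∀ t, HasDerivAt z (-(x t * y t)) t) :
    SolvesEvolution (fun t => (x t : ℂ)) (fun t => (y t : ℂ)) (fun t => (z t : ℂ)) where
  deriv_one t := (hx t).ofReal_comp.congr_deriv (by simp)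
  deriv_two t := (hy t).ofReal_comp.congr_deriv (by simp)
  deriv_three t := (hz t).ofReal_comp.congr_deriv (by simp)

/-! ### Jacobi elliptic functions -/

/-- The two quadratic identities bound dn² below by 1 - k² > 0. So dn never vanishes, and by
continuity it keeps the sign it has at 0. -/
theorem IsJacobiTriple.sqrt_one_sub_le_dn {k : ℝ} {s c d : ℝ → ℝ} (h : IsJacobiTriple k s c d)
    (h0 : 0 ≤ k) (h1 : k < 1) (t : ℝ) : √(1 - k ^ 2) ≤ d t := by
  have hk : 0 < 1 - k ^ 2 := by nlinarith
  have hge : ∀ t, 1 - k ^ 2 ≤ d t ^ 2 := fun t => by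
    nlinarith [h.sq_add_dn_sq t, h.sq_add_sq t, sq_nonneg (c t), sq_nonneg k,
      mul_nonneg (sq_nonneg k) (sq_nonneg (c t))]
  have hdc : Continuous d := continuous_iff_continuousAt.2 fun t => (h.deriv_dn t).continuousAt
  have hpos : 0 < d t := by
    by_contra! hneg
    obtain ⟨x, hx⟩ := mem_range_of_exists_le_of_exists_ge hdc ⟨t, hneg⟩
      ⟨0, by rw [h.dn_zero]; exact zero_le_one⟩
    have := hge x
    rw [hx] at this
    linarith
  exact Real.sqrt_le_iff.2 ⟨hpos.le, hge t⟩

/-- The amplitude am = ∫ dn satisfies sn = sin am and cn = cos am, and it grows at least linearly,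
so it reaches 2π at some T > 0. There the triple is back at its initial value, and uniqueness gives
the period. -/
theorem IsJacobiTriple.exists_periodic {k : ℝ} {s c d : ℝ → ℝ} (h : IsJacobiTriple k s c d)
    (h0 : 0 ≤ k) (h1 : k < 1) :
    ∃ T : ℝ, 0 < T ∧ Function.Periodic s T ∧ Function.Periodic c T ∧ Function.Periodic d T := by
  have hdc : Continuous d := continuous_iff_continuousAt.2 fun t => (h.deriv_dn t).continuousAt
  set m := √(1 - k ^ 2) with hm
  have hmpos : 0 < m := Real.sqrt_pos.2 (by nlinarith)
  let am : ℝ → ℝ := fun t => ∫ y in (0 : ℝ)..t, d y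
  have ham : ∀ t, HasDerivAt am (d t) t := fun t =>
    (hdc.integral_hasStrictDerivAt 0 t).hasDerivAt
  have ham0 : am 0 = 0 := by simp [am]
  -- (sn, cn) and (sin am, cos am) solve the same rotation equation x' = dn y, y' = -dn x, which
  -- preserves their distance.
  have hconst : ∀ t, (s t - Real.sin (am t)) ^ 2 + (c t - Real.cos (am t)) ^ 2 = 0 := by
    have hd : ∀ t, HasDerivAt
        (fun t => (s t - Real.sin (am t)) ^ 2 + (c t - Real.cos (am t)) ^ 2) 0 t := fun t => by
      refine ((((h.deriv_sn t).sub (ham t).sin).pow 2).add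
        (((h.deriv_cn t).sub (ham t).cos).pow 2)).congr_deriv ?_
      push_cast
      simp only [Pi.sub_apply]
      ring
    intro t
    have := is_const_of_deriv_eq_zero (fun x => (hd x).differentiableAt) (fun x => (hd x).deriv) t 0
    simpa [h.sn_zero, h.cn_zero, ham0] using this
  have hs : ∀ t, s t = Real.sin (am t) := fun t => by
    nlinarith [hconst t, sq_nonneg (s t - Real.sin (am t)), sq_nonneg (c t - Real.cos (am t))]
  have hc : ∀ t, c t = Real.cos (am t) := fun t => by
    nlinarith [hconst t, sq_nonneg (s t - Real.sin (am t)), sq_nonneg (c t - Real.cos (am t))]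
  have hgrow : Monotone fun t => am t - m * t :=
    monotone_of_hasDerivAt_nonneg (f' := fun t => d t - m)
      (fun t => (ham t).sub (by simpa using (hasDerivAt_id t).const_mul m))
      fun t => sub_nonneg.2 (h.sqrt_one_sub_le_dn h0 h1 t)
  have hpi := Real.pi_pos
  obtain ⟨T, hT⟩ : ∃ T, am T = 2 * Real.pi := by
    refine mem_range_of_exists_le_of_exists_ge
      (continuous_iff_continuousAt.2 fun t => (ham t).continuousAt)
      ⟨0, by rw [ham0]; positivity⟩ ⟨2 * Real.pi / m, ?_⟩
    have h2 : (0 : ℝ) ≤ 2 * Real.pi / m := by positivity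
    have h3 := hgrow h2
    simp only [ham0, mul_zero, sub_zero, mul_div_cancel₀ _ hmpos.ne'] at h3
    linarith
  have hTpos : 0 < T := by
    by_contra! hneg
    have h3 := hgrow hneg
    simp only [ham0, mul_zero, sub_zero, hT] at h3
    nlinarith
  have hsT : s T = 0 := by rw [hs, hT, Real.sin_two_pi]
  have hcT : c T = 1 := by rw [hc, hT, Real.cos_two_pi]
  have hdT : d T = 1 := by
    have h2 := h.sq_add_dn_sq T
    have h3 := h.sqrt_one_sub_le_dn h0 h1 T
    rw [hsT] at h2
    nlinarith
  have hshift : IsJacobiTriple k (fun t => s (t + T)) (fun t => c (t + T)) (fun t => d (t + T)) :=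
    { deriv_sn := fun t => (h.deriv_sn (t + T)).comp_add_const t T
      deriv_cn := fun t => (h.deriv_cn (t + T)).comp_add_const t T
      deriv_dn := fun t => (h.deriv_dn (t + T)).comp_add_const t T
      sn_zero := by simpa using hsT
      cn_zero := by simpa using hcT
      dn_zero := by simpa using hdT }
  obtain ⟨e1, e2, e3⟩ := hshift.unique h
  exact ⟨T, hTpos, congrFun e1, congrFun e2, congrFun e3⟩

/-! ### Conserved quantities -/

namespace SolvesEvolution

variable {w₁ w₂ w₃ : ℝ → ℂ}

theorem hasDerivAt_norm_sq_one (hw : SolvesEvolution w₁ w₂ w₃) (t : ℝ) :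
    HasDerivAt (fun t => ‖w₁ t‖ ^ 2) (2 * (w₁ t * w₂ t * w₃ t).re) t := by
  refine (hw.deriv_one t).norm_sq.congr_deriv ?_
  simp [Complex.inner]
  ring

theorem hasDerivAt_norm_sq_two (hw : SolvesEvolution w₁ w₂ w₃) (t : ℝ) :
    HasDerivAt (fun t => ‖w₂ t‖ ^ 2) (-(2 * (w₁ t * w₂ t * w₃ t).re)) t := by
  refine (hw.deriv_two t).norm_sq.congr_deriv ?_
  simp [Complex.inner]
  ring

theorem hasDerivAt_norm_sq_three (hw : SolvesEvolution w₁ w₂ w₃) (t : ℝ) :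
    HasDerivAt (fun t => ‖w₃ t‖ ^ 2) (-(2 * (w₁ t * w₂ t * w₃ t).re)) t := by
  refine (hw.deriv_three t).norm_sq.congr_deriv ?_
  simp [Complex.inner]
  ring

/-- Each equation turns its term of the product rule into plus or minus a squared modulus. The
derivative is therefore real, which is why the imaginary part is conserved. -/
theorem hasDerivAt_mul (hw : SolvesEvolution w₁ w₂ w₃) (t : ℝ) :
    HasDerivAt (fun t => w₁ t * w₂ t * w₃ t)
      (((‖w₂ t‖ ^ 2 * ‖w₃ t‖ ^ 2 - ‖w₃ t‖ ^ 2 * ‖w₁ t‖ ^ 2 - ‖w₁ t‖ ^ 2 * ‖w₂ t‖ ^ 2 : ℝ)) : ℂ)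
      t := by
  refine (((hw.deriv_one t).mul (hw.deriv_two t)).mul (hw.deriv_three t)).congr_deriv ?_
  push_cast
  simp only [← Complex.mul_conj', map_mul, Pi.mul_apply]
  ring

theorem norm_sq_add_two (hw : SolvesEvolution w₁ w₂ w₃) (s t : ℝ) :
    ‖w₁ s‖ ^ 2 + ‖w₂ s‖ ^ 2 = ‖w₁ t‖ ^ 2 + ‖w₂ t‖ ^ 2 := by
  have hd := fun t => ((hw.hasDerivAt_norm_sq_one t).add (hw.hasDerivAt_norm_sq_two t)).congr_deriv
    (add_neg_cancel _)
  exact is_const_of_deriv_eq_zero (fun x => (hd x).differentiableAt) (fun x => (hd x).deriv) s t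

theorem norm_sq_add_three (hw : SolvesEvolution w₁ w₂ w₃) (s t : ℝ) :
    ‖w₁ s‖ ^ 2 + ‖w₃ s‖ ^ 2 = ‖w₁ t‖ ^ 2 + ‖w₃ t‖ ^ 2 := by
  have hd := fun t =>
    ((hw.hasDerivAt_norm_sq_one t).add (hw.hasDerivAt_norm_sq_three t)).congr_deriv
      (add_neg_cancel _)
  exact is_const_of_deriv_eq_zero (fun x => (hd x).differentiableAt) (fun x => (hd x).deriv) s t

theorem hasDerivAt_re (hw : SolvesEvolution w₁ w₂ w₃) (t : ℝ) :
    HasDerivAt (fun t => (w₁ t * w₂ t * w₃ t).re)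
      (‖w₂ t‖ ^ 2 * ‖w₃ t‖ ^ 2 - ‖w₃ t‖ ^ 2 * ‖w₁ t‖ ^ 2 - ‖w₁ t‖ ^ 2 * ‖w₂ t‖ ^ 2) t := by
  have := Complex.reCLM.hasFDerivAt.comp_hasDerivAt t (hw.hasDerivAt_mul t)
  rwa [Complex.reCLM_apply, Complex.ofReal_re] at this

theorem im_mul_eq (hw : SolvesEvolution w₁ w₂ w₃) (s t : ℝ) :
    (w₁ s * w₂ s * w₃ s).im = (w₁ t * w₂ t * w₃ t).im := by
  have hd : ∀ t, HasDerivAt (fun t => (w₁ t * w₂ t * w₃ t).im) 0 t := fun t => by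
    have := Complex.imCLM.hasFDerivAt.comp_hasDerivAt t (hw.hasDerivAt_mul t)
    rwa [Complex.imCLM_apply, Complex.ofReal_im] at this
  exact is_const_of_deriv_eq_zero (fun x => (hd x).differentiableAt) (fun x => (hd x).deriv) s t

/-! ### The moduli -/

theorem existsUnique_isModuli (hw : SolvesEvolution w₁ w₂ w₃)
    (hgen : ∃ t, w₁ t ≠ 0 ∧ w₂ t ≠ 0 ∧ w₃ t ≠ 0) :
    ∃! α : ℝ × ℝ × ℝ, ∃ u : ℝ → ℝ, IsModuli w₁ w₂ w₃ α.1 α.2.1 α.2.2 u := by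
  obtain ⟨t₀, h1, h2, h3⟩ := hgen
  have p1 : 0 < ‖w₁ t₀‖ ^ 2 := by positivity
  have p2 : 0 < ‖w₂ t₀‖ ^ 2 := by positivity
  have p3 : 0 < ‖w₃ t₀‖ ^ 2 := by positivity
  have e2 := fun t => hw.norm_sq_add_two t t₀
  have e3 := fun t => hw.norm_sq_add_three t t₀
  set c₂ := ‖w₁ t₀‖ ^ 2 + ‖w₂ t₀‖ ^ 2
  set c₃ := ‖w₁ t₀‖ ^ 2 + ‖w₃ t₀‖ ^ 2
  have hc2 : 0 < c₂ := by positivity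
  have hc3 : 0 < c₃ := by positivity
  -- With c₂ = α₁ + α₂ and c₃ = α₁ + α₃, the reciprocal relation becomes 3α₁² - 2(c₂ + c₃)α₁ + c₂c₃
  -- = 0; D² is a quarter of its discriminant.
  set D := √((c₂ + c₃) ^ 2 - 3 * (c₂ * c₃)) with hD
  have hD2 : D ^ 2 = (c₂ + c₃) ^ 2 - 3 * (c₂ * c₃) :=
    Real.sq_sqrt (by nlinarith [sq_nonneg (c₂ - c₃), mul_pos hc2 hc3])
  have hD0 : 0 ≤ D := Real.sqrt_nonneg _
  have hDlt : D < c₂ + c₃ := by nlinarith [mul_pos hc2 hc3]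
  have hD2' : c₃ - 2 * c₂ < D := by
    by_contra! hle
    nlinarith [mul_pos hc2 hc3]
  have hD3' : c₂ - 2 * c₃ < D := by
    by_contra! hle
    nlinarith [mul_pos hc2 hc3]
  refine ⟨((c₂ + c₃ - D) / 3, c₂ - (c₂ + c₃ - D) / 3, c₃ - (c₂ + c₃ - D) / 3),
    ⟨fun t => ‖w₁ t‖ ^ 2 - (c₂ + c₃ - D) / 3, ?_⟩, ?_⟩
  · have q1 : 0 < (c₂ + c₃ - D) / 3 := by linarith
    have q2 : 0 < c₂ - (c₂ + c₃ - D) / 3 := by linarith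
    have q3 : 0 < c₃ - (c₂ + c₃ - D) / 3 := by linarith
    refine ⟨q1, q2, q3, ?_, fun t => by ring, fun t => ?_, fun t => ?_⟩
    · rw [div_add_div _ _ q2.ne' q3.ne', div_eq_div_iff q1.ne' (by positivity)]
      nlinarith
    · linarith [e2 t]
    · linarith [e3 t]
  · rintro ⟨x, y, z⟩ ⟨u, hx, hy, hz, hinv, n1, n2, n3⟩
    simp only at hx hy hz hinv n1 n2 n3
    have hy' : y = c₂ - x := by linarith [n1 t₀, n2 t₀]
    have hz' : z = c₃ - x := by linarith [n1 t₀, n3 t₀]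
    rw [div_add_div _ _ hy.ne' hz.ne', div_eq_div_iff hx.ne' (by positivity), hy', hz'] at hinv
    have hfac : (c₂ + c₃ - 3 * x - D) * (c₂ + c₃ - 3 * x + D) = 0 := by nlinarith
    have hx' : x = (c₂ + c₃ - D) / 3 := by
      rcases mul_eq_zero.1 hfac with h | h
      · linarith
      · exfalso
        -- The larger root would give α₂ + α₃ ≤ α₁, which is incompatible with α₁(α₂ + α₃) = α₂α₃
        -- for positive αⱼ.
        have : c₂ + c₃ - 3 * x ≤ 0 := by linarith
        rw [hy'] at hy
        rw [hz'] at hz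
        nlinarith [mul_pos hy hz]
    simp only [hy', hz', hx']

end SolvesEvolution

/-! ### Phases -/

namespace IsPhase

/-- The function e^{-iθ}w = √r is real, so the imaginary part of its derivative vanishes; this
equation determines θ' without differentiating √r. -/
theorem hasDerivAt {w : ℝ → ℂ} {r θ : ℝ → ℝ} (h : IsPhase w r θ) {t : ℝ} {w' : ℂ}
    (hw : HasDerivAt w w' t) (hr : 0 < r t) :
    HasDerivAt θ ((starRingEnd ℂ (w t) * w').im / r t) t := by
  have hsq : √(r t) * √(r t) = r t := Real.mul_self_sqrt hr.le
  have hne : w t ≠ 0 := by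
    rw [h.polar t]
    exact mul_ne_zero (Complex.exp_ne_zero _)
      (Complex.ofReal_ne_zero.2 (Real.sqrt_pos.2 hr).ne')
  have hθ := (h.differentiableAt t hne).hasDerivAt
  generalize deriv θ t = d at hθ
  refine hθ.congr_deriv ?_
  let E : ℝ → ℂ := fun s => Complex.exp (-(Complex.I * (θ s : ℂ)))
  have hE : ∀ s, E s * w s = (√(r s) : ℂ) := fun s => by
    simp only [E]
    rw [h.polar s, ← mul_assoc, ← Complex.exp_add, neg_add_cancel, Complex.exp_zero, one_mul]
  have hEd : HasDerivAt E (E t * -(Complex.I * (d : ℂ))) t :=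
    (hθ.ofReal_comp.const_mul Complex.I).fun_neg.cexp
  have him := Complex.imCLM.hasFDerivAt.comp_hasDerivAt t (hEd.mul hw)
  have hzero : HasDerivAt (Complex.imCLM ∘ (E * w)) 0 t := by
    have : Complex.imCLM ∘ (E * w) = fun _ => (0 : ℝ) := by
      funext s
      simp [-Complex.mul_im, hE s]
    rw [this]
    exact hasDerivAt_const t 0
  have heq : (E t * -(Complex.I * (d : ℂ)) * w t + E t * w').im = 0 := him.unique hzero
  have hval : E t * -(Complex.I * (d : ℂ)) * w t + E t * w' =
      E t * w' - Complex.I * ((d * √(r t) : ℝ) : ℂ) := by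
    push_cast
    rw [← hE t]
    ring
  have hconj : starRingEnd ℂ (w t) = (√(r t) : ℂ) * E t := by
    rw [h.polar t, map_mul, ← Complex.exp_conj]
    simp [E, mul_comm]
  rw [hval, Complex.sub_im, Complex.I_mul_im, Complex.ofReal_re, sub_eq_zero] at heq
  rw [hconj, mul_assoc, Complex.im_ofReal_mul, heq, eq_div_iff hr.ne']
  linear_combination -d * hsq

theorem apply_of_eq_zero {w : ℝ → ℂ} {r θ : ℝ → ℝ} (h : IsPhase w r θ) {t : ℝ} (h0 : θ t = 0) :
    w t = (√(r t) : ℂ) := by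
  rw [h.polar t, h0]
  simp

end IsPhase

theorem IsPolarForm.im_mul {w₁ w₂ w₃ : ℝ → ℂ} {α₁ α₂ α₃ : ℝ} {u θ₁ θ₂ θ₃ : ℝ → ℝ}
    (h : IsPolarForm w₁ w₂ w₃ α₁ α₂ α₃ u θ₁ θ₂ θ₃) (t : ℝ) :
    √(evolutionQ α₁ α₂ α₃ (u t)) * Real.sin (θ₁ t + θ₂ t + θ₃ t) =
      (w₁ t * w₂ t * w₃ t).im := by
  have h1 : 0 ≤ α₁ + u t := by rw [← h.moduli.norm_one t]; positivity
  have h2 : 0 ≤ α₂ - u t := by rw [← h.moduli.norm_two t]; positivity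
  have hprod : w₁ t * w₂ t * w₃ t =
      ((√(α₁ + u t) * √(α₂ - u t) * √(α₃ - u t) : ℝ) : ℂ) *
        Complex.exp (((θ₁ t + θ₂ t + θ₃ t : ℝ) : ℂ) * Complex.I) := by
    rw [h.phase_one.polar t, h.phase_two.polar t, h.phase_three.polar t]
    have : (((θ₁ t + θ₂ t + θ₃ t : ℝ) : ℂ) * Complex.I) =
        Complex.I * (θ₁ t : ℂ) + Complex.I * (θ₂ t : ℂ) + Complex.I * (θ₃ t : ℂ) := by
      push_cast
      ring
    rw [this, Complex.exp_add, Complex.exp_add]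
    push_cast
    ring
  rw [hprod, Complex.im_ofReal_mul, Complex.exp_ofReal_mul_I_im, evolutionQ,
    Real.sqrt_mul (mul_nonneg h1 h2), Real.sqrt_mul h1]

/-- Otherwise the solution would be the stationary one (w₁(0), 0, 0), against genericity. -/
theorem SolvesEvolution.three_ne_zero_of_two_eq_zero {w₁ w₂ w₃ : ℝ → ℂ}
    (hw : SolvesEvolution w₁ w₂ w₃)
    (hgen : ∃ t, w₁ t ≠ 0 ∧ w₂ t ≠ 0 ∧ w₃ t ≠ 0) (h2 : w₂ 0 = 0) : w₃ 0 ≠ 0 := by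
  intro h3
  have hz : SolvesEvolution (fun _ => w₁ 0) (fun _ => 0) (fun _ => 0) :=
    ⟨fun t => by simpa using hasDerivAt_const t (w₁ 0), fun t => by simpa using hasDerivAt_const t 0,
      fun t => by simpa using hasDerivAt_const t 0⟩
  obtain ⟨t, -, h, -⟩ := hgen
  exact h (congrFun (hw.eq_of_eq_zero hz rfl h2 h3).2.1 t)

/-! ### The equation for `u` -/

/-- The derivative `Q'(x)`. -/
def evolutionQDeriv (α₁ α₂ α₃ x : ℝ) : ℝ :=
  (α₂ - x) * (α₃ - x) - (α₃ - x) * (α₁ + x) - (α₁ + x) * (α₂ - x)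

namespace IsModuli

variable {w₁ w₂ w₃ : ℝ → ℂ} {α₁ α₂ α₃ : ℝ} {u : ℝ → ℝ}

/-- This form of the reciprocal relation is Q'(0) = 0. -/
theorem mul_eq (hm : IsModuli w₁ w₂ w₃ α₁ α₂ α₃ u) : α₁ * (α₂ + α₃) = α₂ * α₃ := by
  have h1 := hm.pos_one
  have h2 := hm.pos_two
  have h3 := hm.pos_three
  have := hm.inv_eq
  field_simp at this
  linarith

theorem norm_sq_eq (hm : IsModuli w₁ w₂ w₃ α₁ α₂ α₃ u) (t : ℝ) :
    (w₁ t * w₂ t * w₃ t).re ^ 2 + (w₁ t * w₂ t * w₃ t).im ^ 2 = evolutionQ α₁ α₂ α₃ (u t) := by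
  rw [evolutionQ, ← hm.norm_one, ← hm.norm_two, ← hm.norm_three, ← mul_pow, ← mul_pow,
    ← norm_mul, ← norm_mul, Complex.sq_norm, Complex.normSq_apply]
  ring

theorem hasDerivAt (hm : IsModuli w₁ w₂ w₃ α₁ α₂ α₃ u) (hw : SolvesEvolution w₁ w₂ w₃) (t : ℝ) :
    HasDerivAt u (2 * (w₁ t * w₂ t * w₃ t).re) t := by
  have : u = fun t => ‖w₁ t‖ ^ 2 - α₁ := by
    funext t
    linarith [hm.norm_one t]
  rw [this]
  exact (hw.hasDerivAt_norm_sq_one t).sub_const α₁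

theorem hasDerivAt_re (hm : IsModuli w₁ w₂ w₃ α₁ α₂ α₃ u) (hw : SolvesEvolution w₁ w₂ w₃)
    (t : ℝ) :
    HasDerivAt (fun t => 2 * (w₁ t * w₂ t * w₃ t).re) (2 * evolutionQDeriv α₁ α₂ α₃ (u t)) t := by
  refine ((hw.hasDerivAt_re t).const_mul 2).congr_deriv ?_
  rw [evolutionQDeriv, hm.norm_one, hm.norm_two, hm.norm_three]

theorem re_eq_zero_of_isLocalMin (hm : IsModuli w₁ w₂ w₃ α₁ α₂ α₃ u)
    (hw : SolvesEvolution w₁ w₂ w₃) {t : ℝ} (h : IsLocalMin u t) :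
    (w₁ t * w₂ t * w₃ t).re = 0 := by
  have := h.hasDerivAt_eq_zero (hm.hasDerivAt hw t)
  linarith

/-- If u'' were negative, t would also be a local maximum, making u locally constant and u'' zero.
-/
theorem evolutionQDeriv_nonneg_of_isLocalMin (hm : IsModuli w₁ w₂ w₃ α₁ α₂ α₃ u)
    (hw : SolvesEvolution w₁ w₂ w₃) {t : ℝ} (h : IsLocalMin u t) :
    0 ≤ evolutionQDeriv α₁ α₂ α₃ (u t) := by
  by_contra! hneg
  have hd : deriv u = fun t => 2 * (w₁ t * w₂ t * w₃ t).re :=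
    funext fun t => (hm.hasDerivAt hw t).deriv
  have hdd : deriv (deriv u) t = 2 * evolutionQDeriv α₁ α₂ α₃ (u t) := by
    rw [hd]
    exact (hm.hasDerivAt_re hw t).deriv
  have hmax : IsLocalMax u t := isLocalMax_of_deriv_deriv_neg (by rw [hdd]; linarith)
    h.deriv_eq_zero (hm.hasDerivAt hw t).continuousAt
  have hconst : u =ᶠ[nhds t] fun _ => u t := by
    filter_upwards [h, hmax] with x h1 h2 using le_antisymm h2 h1
  have : deriv (deriv u) t = 0 := by
    rw [hconst.deriv.deriv_eq]
    simp
  linarith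

/-- The critical points of Q are 0 and x₊ = 2(α₂ + α₃ - α₁)/3, so Q'(u(0)) ≥ 0 with u(0) > 0 forces
u(0) ≥ x₊. But u(0) ≤ α₂, and α₂ < x₊ when α₂ < α₃. If α₂ = α₃, then x₊ = α₂, so w₂ and w₃ both
vanish at 0. -/
theorem nonpos_of_isLocalMin (hm : IsModuli w₁ w₂ w₃ α₁ α₂ α₃ u)
    (hw : SolvesEvolution w₁ w₂ w₃) (hgen : ∃ t, w₁ t ≠ 0 ∧ w₂ t ≠ 0 ∧ w₃ t ≠ 0)
    (hle : α₂ ≤ α₃) (h : IsLocalMin u 0) : u 0 ≤ 0 := by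
  have hQ := hm.evolutionQDeriv_nonneg_of_isLocalMin hw h
  have h2 : 0 ≤ α₂ - u 0 := by rw [← hm.norm_two]; positivity
  have hp1 := hm.pos_one
  have hp2 := hm.pos_two
  have hp3 := hm.pos_three
  have hmul := hm.mul_eq
  by_contra! hpos
  have hfac : evolutionQDeriv α₁ α₂ α₃ (u 0) = u 0 * (3 * u 0 - 2 * (α₂ + α₃ - α₁)) := by
    rw [evolutionQDeriv]
    linarith
  rw [hfac] at hQ
  have h3 : 0 ≤ 3 * u 0 - 2 * (α₂ + α₃ - α₁) := nonneg_of_mul_nonneg_right hQ hpos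
  have h23 : α₂ = α₃ := by
    by_contra hne
    have hlt := lt_of_le_of_ne hle hne
    nlinarith [mul_pos hp2 (sub_pos.2 hlt), mul_pos hp3 (sub_pos.2 hlt)]
  have h4 : u 0 = α₂ := by
    subst h23
    have : α₂ = 2 * α₁ := by nlinarith
    linarith
  have z2 : w₂ 0 = 0 := by simpa [h4] using hm.norm_two 0
  have z3 : w₃ 0 = 0 := by simpa [h4, h23] using hm.norm_three 0
  exact hw.three_ne_zero_of_two_eq_zero hgen z2 z3

end IsModuli

/-! ### Explicit solutions -/

theorem jacobi_modulus_one (t : ℝ) : jacobiSn t 1 = Real.tanh t ∧ jacobiCn t 1 = (Real.cosh t)⁻¹ ∧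
    jacobiDn t 1 = (Real.cosh t)⁻¹ := by
  have hc : ∀ t : ℝ, Real.cosh t ≠ 0 := fun t => (Real.cosh_pos t).ne'
  have hd : ∀ t, HasDerivAt (fun t => (Real.cosh t)⁻¹)
      (-(Real.tanh t * (Real.cosh t)⁻¹)) t := fun t => by
    refine ((Real.hasDerivAt_cosh t).inv (hc t)).congr_deriv ?_
    have := hc t
    rw [Real.tanh_eq_sinh_div_cosh]
    field_simp
  have h : IsJacobiTriple 1 Real.tanh (fun t => (Real.cosh t)⁻¹) (fun t => (Real.cosh t)⁻¹) := by
    refine ⟨fun t => ?_, hd, fun t => by simpa using hd t, by simp, by simp, by simp⟩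
    have h2 := (Real.hasDerivAt_sinh t).div (Real.hasDerivAt_cosh t) (hc t)
    have h3 : Real.tanh = Real.sinh / Real.cosh := by
      funext x
      simp [Real.tanh_eq_sinh_div_cosh]
    rw [h3]
    refine h2.congr_deriv ?_
    have h4 := Real.cosh_sq t
    have := hc t
    field_simp
    linarith
  obtain ⟨e1, e2, e3⟩ := (isJacobiTriple_jacobi zero_le_one le_rfl).unique h
  exact ⟨congrFun e1 t, congrFun e2 t, congrFun e3 t⟩

/-- The modulus p/q is what makes the factor k²q² in the third equation equal to p². -/
theorem solvesEvolution_jacobi {p q : ℝ} (hp : 0 < p) (hpq : p ≤ q) :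
    SolvesEvolution (fun t => ((p * jacobiSn (q * t) (p / q) : ℝ) : ℂ))
      (fun t => ((p * jacobiCn (q * t) (p / q) : ℝ) : ℂ))
      (fun t => ((q * jacobiDn (q * t) (p / q) : ℝ) : ℂ)) := by
  have hq : 0 < q := hp.trans_le hpq
  have h := isJacobiTriple_jacobi (div_nonneg hp.le hq.le) ((div_le_one hq).2 hpq)
  have hl : ∀ t, HasDerivAt (fun t => q * t) q t := fun t => by
    simpa using (hasDerivAt_id t).const_mul q
  refine solvesEvolution_ofReal (fun t => ?_) (fun t => ?_) (fun t => ?_)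
  · exact (((h.deriv_sn (q * t)).comp t (hl t)).const_mul p).congr_deriv (by ring)
  · exact (((h.deriv_cn (q * t)).comp t (hl t)).const_mul p).congr_deriv (by ring)
  · refine (((h.deriv_dn (q * t)).comp t (hl t)).const_mul q).congr_deriv ?_
    field_simp

/-- As the frequencies sum to zero, the phase of w₁w₂w₃ stays at π/2, and each conjugate product
rotates at the frequency of the remaining component. -/
theorem solvesEvolution_exp {p q r : ℝ} (hp : 0 < p) (hq : 0 < q) (hr : 0 < r)
    (hsum : -(q * r / p) + r * p / q + p * q / r = 0) :
    SolvesEvolution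
      (fun t => Complex.I * (p : ℂ) * Complex.exp (Complex.I * ((-(q * r / p) : ℝ) : ℂ) * (t : ℂ)))
      (fun t => (q : ℂ) * Complex.exp (Complex.I * ((r * p / q : ℝ) : ℂ) * (t : ℂ)))
      (fun t => (r : ℂ) * Complex.exp (Complex.I * ((p * q / r : ℝ) : ℂ) * (t : ℂ))) := by
  have hp' : (p : ℂ) ≠ 0 := Complex.ofReal_ne_zero.2 hp.ne'
  have hq' : (q : ℂ) ≠ 0 := Complex.ofReal_ne_zero.2 hq.ne'
  have hr' : (r : ℂ) ≠ 0 := Complex.ofReal_ne_zero.2 hr.ne'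
  have hd : ∀ (c : ℂ) (a t : ℝ), HasDerivAt
      (fun t : ℝ => c * Complex.exp (Complex.I * (a : ℂ) * (t : ℂ)))
      (c * (Complex.exp (Complex.I * (a : ℂ) * (t : ℂ)) * (Complex.I * (a : ℂ)))) t :=
    fun c a t => by
      have h1 : HasDerivAt (fun t : ℝ => Complex.I * (a : ℂ) * (t : ℂ))
          (Complex.I * (a : ℂ)) t := by
        simpa using ((hasDerivAt_id t).ofReal_comp).const_mul (Complex.I * (a : ℂ))
      exact h1.cexp.const_mul c
  have hconj : ∀ a t : ℝ, starRingEnd ℂ (Complex.exp (Complex.I * (a : ℂ) * (t : ℂ))) =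
      Complex.exp (-(Complex.I * (a : ℂ) * (t : ℂ))) := fun a t => by
    rw [← Complex.exp_conj]
    simp
  have hexp : ∀ (a b c t : ℝ), a + b + c = 0 →
      Complex.exp (Complex.I * (a : ℂ) * (t : ℂ)) =
        Complex.exp (-(Complex.I * (b : ℂ) * (t : ℂ))) *
          Complex.exp (-(Complex.I * (c : ℂ) * (t : ℂ))) := fun a b c t h => by
    rw [← Complex.exp_add]
    congr 1
    have : a = -b - c := by linarith
    rw [this]
    push_cast
    ring
  refine ⟨fun t => (hd _ _ t).congr_deriv ?_, fun t => (hd _ _ t).congr_deriv ?_,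
    fun t => (hd _ _ t).congr_deriv ?_⟩
  · simp only [map_mul, hconj, Complex.conj_ofReal]
    rw [hexp _ _ _ t hsum]
    push_cast
    field_simp
    simp
  · simp only [map_mul, hconj, Complex.conj_ofReal, Complex.conj_I]
    rw [hexp (r * p / q) (p * q / r) (-(q * r / p)) t (by linarith)]
    push_cast
    field_simp
  · simp only [map_mul, hconj, Complex.conj_ofReal, Complex.conj_I]
    rw [hexp (p * q / r) (-(q * r / p)) (r * p / q) t (by linarith)]
    push_cast
    field_simp

/-! ### The roots of `Q - A²` and the solution for `u` -/

theorem exists_roots_evolutionQ {α₁ α₂ α₃ A γ₁ : ℝ} (h2 : 0 < α₂) (hle : α₂ ≤ α₃)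
    (hA : 0 < A) (hA' : A ^ 2 < α₁ * α₂ * α₃) (hγ : γ₁ ≤ 0)
    (hroot : evolutionQ α₁ α₂ α₃ γ₁ = A ^ 2) :
    ∃ γ₂ γ₃ : ℝ, 0 ≤ γ₂ ∧ γ₂ ≤ γ₃ ∧ γ₂ < α₂ ∧
      ∀ x : ℝ, evolutionQ α₁ α₂ α₃ x - A ^ 2 = (x - γ₁) * (x - γ₂) * (x - γ₃) := by
  have hA2 : 0 < A ^ 2 := by positivity
  have hcont : Continuous (evolutionQ α₁ α₂ α₃) := by
    unfold evolutionQ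
    fun_prop
  -- Q falls from α₁α₂α₃ > A² at 0 to 0 < A² at α₂, so there is a root in between.
  obtain ⟨γ₂, ⟨hγ0, hγ2⟩, hroot2⟩ := intermediate_value_Ioo' h2.le hcont.continuousOn
    (show A ^ 2 ∈ Set.Ioo (evolutionQ α₁ α₂ α₃ α₂) (evolutionQ α₁ α₂ α₃ 0) by
      constructor <;> simp [evolutionQ] <;> linarith)
  have hne : γ₂ - γ₁ ≠ 0 := by linarith
  -- The third root comes from the sum of the roots. The two monic cubics then differ by an affine
  -- function vanishing at γ₁ and γ₂; multiplying by γ₂ - γ₁ expresses it by linear interpolation.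
  have hfac : ∀ x : ℝ, evolutionQ α₁ α₂ α₃ x - A ^ 2 =
      (x - γ₁) * (x - γ₂) * (x - (α₂ + α₃ - α₁ - γ₁ - γ₂)) := fun x => by
    refine mul_left_cancel₀ hne ?_
    unfold evolutionQ at *
    linear_combination (γ₂ - x) * hroot + (x - γ₁) * hroot2
  refine ⟨γ₂, α₂ + α₃ - α₁ - γ₁ - γ₂, hγ0.le, ?_, hγ2, hfac⟩
  -- If γ₃ < γ₂ < α₂ ≤ α₃, the factored cubic is positive at α₃, where Q - A² equals -A².
  by_contra! hlt
  have h := hfac α₃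
  have h' : 0 < (α₃ - γ₁) * (α₃ - γ₂) * (α₃ - (α₂ + α₃ - α₁ - γ₁ - γ₂)) :=
    mul_pos (mul_pos (by linarith) (by linarith)) (by linarith)
  simp only [evolutionQ, sub_self, mul_zero] at h
  linarith

theorem evolutionQDeriv_eq_of_roots {α₁ α₂ α₃ A γ₁ γ₂ γ₃ : ℝ}
    (h : ∀ x : ℝ, evolutionQ α₁ α₂ α₃ x - A ^ 2 = (x - γ₁) * (x - γ₂) * (x - γ₃)) (x : ℝ) :
    evolutionQDeriv α₁ α₂ α₃ x =
      (x - γ₂) * (x - γ₃) + (x - γ₃) * (x - γ₁) + (x - γ₁) * (x - γ₂) := by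
  -- Coefficients are compared by evaluating at a few points.
  have h0 := h 0
  have h1 := h 1
  have h2 := h (-1)
  have h3 := h 2
  simp only [evolutionQ] at h0 h1 h2 h3
  have e1 : α₁ - α₂ - α₃ = -(γ₁ + γ₂ + γ₃) := by linarith
  have e2 : α₂ * α₃ - α₁ * α₂ - α₁ * α₃ = γ₁ * γ₂ + γ₂ * γ₃ + γ₁ * γ₃ := by linarith
  rw [evolutionQDeriv]
  linear_combination 2 * x * e1 + e2

theorem IsModuli.eq_jacobiSn {w₁ w₂ w₃ : ℝ → ℂ} {α₁ α₂ α₃ A γ₁ γ₂ γ₃ : ℝ} {u : ℝ → ℝ}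
    (hm : IsModuli w₁ w₂ w₃ α₁ α₂ α₃ u) (hw : SolvesEvolution w₁ w₂ w₃)
    (hre : (w₁ 0 * w₂ 0 * w₃ 0).re = 0) (hu : u 0 = γ₁) (h12 : γ₁ < γ₂) (h23 : γ₂ ≤ γ₃)
    (h : ∀ x : ℝ, evolutionQ α₁ α₂ α₃ x - A ^ 2 = (x - γ₁) * (x - γ₂) * (x - γ₃)) (t : ℝ) :
    u t = γ₁ + (γ₂ - γ₁) * jacobiSn (√(γ₃ - γ₁) * t) (√(γ₂ - γ₁) / √(γ₃ - γ₁)) ^ 2 := by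
  set σ := √(γ₃ - γ₁) with hσ
  set τ := √(γ₂ - γ₁) / √(γ₃ - γ₁) with hτ
  have hσ0 : 0 < σ := Real.sqrt_pos.2 (by linarith)
  have hσ2 : σ ^ 2 = γ₃ - γ₁ := Real.sq_sqrt (by linarith)
  have hτ2 : τ ^ 2 * σ ^ 2 = γ₂ - γ₁ := by
    rw [hτ, ← hσ, div_pow, Real.sq_sqrt (by linarith)]
    field_simp
  have hτ0 : 0 ≤ τ := by positivity
  have hτ1 : τ ≤ 1 := (div_le_one hσ0).2 (Real.sqrt_le_sqrt (by linarith))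
  have hj := isJacobiTriple_jacobi hτ0 hτ1
  have hl : ∀ t, HasDerivAt (fun t => σ * t) σ t := fun t => by
    simpa using (hasDerivAt_id t).const_mul σ
  have hs := fun t => (hj.deriv_sn (σ * t)).comp t (hl t)
  have hc := fun t => (hj.deriv_cn (σ * t)).comp t (hl t)
  have hd := fun t => (hj.deriv_dn (σ * t)).comp t (hl t)
  have hsc := fun t => hj.sq_add_sq (σ * t)
  have hsd := fun t => hj.sq_add_dn_sq (σ * t)
  have hs0 := hj.sn_zero
  simp only [Function.comp_def] at hs hc hd
  set s := fun t => jacobiSn (σ * t) τ with hsdef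
  set c := fun t => jacobiCn (σ * t) τ with hcdef
  set d := fun t => jacobiDn (σ * t) τ with hddef
  -- The first-order equation for u loses uniqueness where u' = 0, as at the initial point; the
  -- second-order system for (u, u') is polynomial, hence locally Lipschitz.
  let V : ℝ × ℝ → ℝ × ℝ := fun p => (p.2, 2 * evolutionQDeriv α₁ α₂ α₃ p.1)
  have hV : ContDiff ℝ 1 V := by
    simp only [V, evolutionQDeriv]
    fun_prop
  have key := eq_of_hasDerivAt_of_locallyLipschitz hV.locallyLipschitz
    (f := fun t => (u t, 2 * (w₁ t * w₂ t * w₃ t).re))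
    (g := fun t => (γ₁ + (γ₂ - γ₁) * s t ^ 2, 2 * (γ₂ - γ₁) * σ * (s t * (c t * d t))))
    (fun t => (hm.hasDerivAt hw t).prodMk (hm.hasDerivAt_re hw t))
    (fun t => by
      refine HasDerivAt.prodMk ?_ ?_
      · refine ((((hs t).pow 2).const_mul (γ₂ - γ₁)).const_add γ₁).congr_deriv ?_
        push_cast
        ring
      · refine (((hs t).mul ((hc t).mul (hd t))).const_mul
          (2 * (γ₂ - γ₁) * σ)).congr_deriv ?_
        simp only [Pi.mul_apply, evolutionQDeriv_eq_of_roots h]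
        have e1 : c t ^ 2 = 1 - s t ^ 2 := by linarith [hsc t]
        have e2 : d t ^ 2 = 1 - τ ^ 2 * s t ^ 2 := by linarith [hsd t]
        have e3 : γ₁ + (γ₂ - γ₁) * s t ^ 2 - γ₂ = -((γ₂ - γ₁) * c t ^ 2) := by rw [e1]; ring
        have e4 : γ₁ + (γ₂ - γ₁) * s t ^ 2 - γ₃ = -(σ ^ 2 * d t ^ 2) := by
          rw [e2]
          linear_combination hσ2 - s t ^ 2 * hτ2
        have e5 : γ₁ + (γ₂ - γ₁) * s t ^ 2 - γ₁ = (γ₂ - γ₁) * s t ^ 2 := by ring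
        simp only [e3, e4, e5]
        linear_combination (-2 * (γ₂ - γ₁) * s t ^ 2 * c t ^ 2) * hτ2)
    (by simp [hsdef, hu, hre, hs0])
  exact congrArg Prod.fst (congrFun key t)

/-! ### The four cases -/

namespace IsPolarForm

variable {w₁ w₂ w₃ : ℝ → ℂ} {α₁ α₂ α₃ : ℝ} {u θ₁ θ₂ θ₃ : ℝ → ℝ}

/-- Both cases are the same Jacobi solution; α₂ = α₃ is modulus 1, where it degenerates to tanh and
sech and periodicity is lost. -/
theorem caseA_or_caseB (hp : IsPolarForm w₁ w₂ w₃ α₁ α₂ α₃ u θ₁ θ₂ θ₃)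
    (hw : SolvesEvolution w₁ w₂ w₃) (hu : u 0 = -α₁) (h2 : θ₂ 0 = 0) (h3 : θ₃ 0 = 0)
    (hle : α₂ ≤ α₃) : CaseA w₁ w₂ w₃ α₁ α₂ α₃ 0 ∨ CaseB w₁ w₂ w₃ α₁ α₂ α₃ 0 := by
  have hm := hp.moduli
  have hp1 := hm.pos_one
  have hp2 := hm.pos_two
  have hp3 := hm.pos_three
  have z1 : w₁ 0 = 0 := by simpa [hu] using hm.norm_one 0
  have z2 : w₂ 0 = (√(α₁ + α₂) : ℝ) := by
    rw [hp.phase_two.apply_of_eq_zero h2, hu, sub_neg_eq_add, add_comm]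
  have z3 : w₃ 0 = (√(α₁ + α₃) : ℝ) := by
    rw [hp.phase_three.apply_of_eq_zero h3, hu, sub_neg_eq_add, add_comm]
  have hpp : 0 < √(α₁ + α₂) := Real.sqrt_pos.2 (by linarith)
  have hpq : √(α₁ + α₂) ≤ √(α₁ + α₃) := Real.sqrt_le_sqrt (by linarith)
  have hq : 0 < √(α₁ + α₃) := hpp.trans_le hpq
  have hτ0 : 0 ≤ √(α₁ + α₂) / √(α₁ + α₃) := by positivity
  have hj := isJacobiTriple_jacobi hτ0 ((div_le_one hq).2 hpq)
  have s0 := hj.sn_zero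
  have c0 := hj.cn_zero
  have d0 := hj.dn_zero
  obtain ⟨rfl, rfl, rfl⟩ := hw.eq_of_eq_zero (solvesEvolution_jacobi hpp hpq)
    (by simp [z1, s0]) (by simp [z2, c0]) (by simp [z3, d0])
  rcases hle.eq_or_lt with heq | hlt
  · left
    refine ⟨rfl, heq, fun t => ?_⟩
    subst heq
    have h21 : α₂ = 2 * α₁ := by nlinarith [hm.mul_eq]
    have h31 : α₁ + α₂ = 3 * α₁ := by linarith
    rw [h31] at hq
    obtain ⟨e1, e2, e3⟩ := jacobi_modulus_one (√(3 * α₁) * t)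
    simp only [h31, div_self hq.ne', e1, e2, e3, mul_comm t, and_self]
  · right
    have hτ1 : √(α₁ + α₂) / √(α₁ + α₃) < 1 :=
      (div_lt_one hq).2 (Real.sqrt_lt_sqrt (by linarith) (by linarith))
    refine ⟨rfl, hlt, ⟨_, _, rfl, rfl, fun t => ⟨rfl, rfl, rfl⟩⟩, ?_⟩
    obtain ⟨T, hT, ps, pc, pd⟩ := hj.exists_periodic hτ0 hτ1
    have hmul : ∀ t, √(α₁ + α₃) * (t + T / √(α₁ + α₃)) = √(α₁ + α₃) * t + T := fun t => by
      field_simp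
    refine ⟨T / √(α₁ + α₃), by positivity, fun t => ?_, fun t => ?_, fun t => ?_⟩
    · simp only [hmul]
      exact congrArg (fun x : ℝ => ((√(α₁ + α₂) * x : ℝ) : ℂ)) (ps _)
    · simp only [hmul]
      exact congrArg (fun x : ℝ => ((√(α₁ + α₂) * x : ℝ) : ℂ)) (pc _)
    · simp only [hmul]
      exact congrArg (fun x : ℝ => ((√(α₁ + α₃) * x : ℝ) : ℂ)) (pd _)

theorem caseD (hp : IsPolarForm w₁ w₂ w₃ α₁ α₂ α₃ u θ₁ θ₂ θ₃)
    (hw : SolvesEvolution w₁ w₂ w₃) (hu : u 0 = 0) (h2 : θ₂ 0 = 0) (h3 : θ₃ 0 = 0)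
    (hA : (w₁ 0 * w₂ 0 * w₃ 0).im = √(α₁ * α₂ * α₃)) (hre : (w₁ 0 * w₂ 0 * w₃ 0).re = 0) :
    CaseD w₁ w₂ w₃ α₁ α₂ α₃ √(α₁ * α₂ * α₃) := by
  have hm := hp.moduli
  have hp1 := hm.pos_one
  have hp2 := hm.pos_two
  have hp3 := hm.pos_three
  have z2 : w₂ 0 = (√α₂ : ℝ) := by rw [hp.phase_two.apply_of_eq_zero h2, hu, sub_zero]
  have z3 : w₃ 0 = (√α₃ : ℝ) := by rw [hp.phase_three.apply_of_eq_zero h3, hu, sub_zero]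
  have s1 : 0 < √α₁ := Real.sqrt_pos.2 hp1
  have s2 : 0 < √α₂ := Real.sqrt_pos.2 hp2
  have s3 : 0 < √α₃ := Real.sqrt_pos.2 hp3
  have q1 : √α₁ ^ 2 = α₁ := Real.sq_sqrt hp1.le
  have q2 : √α₂ ^ 2 = α₂ := Real.sq_sqrt hp2.le
  have q3 : √α₃ ^ 2 = α₃ := Real.sq_sqrt hp3.le
  rw [Real.sqrt_mul (by positivity), Real.sqrt_mul hp1.le] at *
  rw [z2, z3, Complex.im_mul_ofReal, Complex.im_mul_ofReal] at hA
  rw [z2, z3, Complex.re_mul_ofReal, Complex.re_mul_ofReal] at hre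
  -- Since w₂(0) and w₃(0) are positive reals, the product w₁w₂w₃ at 0 determines w₁(0).
  have z1 : w₁ 0 = Complex.I * (√α₁ : ℝ) := by
    apply Complex.ext
    · simpa [s2.ne', s3.ne'] using hre
    · simpa using mul_right_cancel₀ s2.ne' (mul_right_cancel₀ s3.ne' hA)
  have hsum : -(√α₂ * √α₃ / √α₁) + √α₃ * √α₁ / √α₂ + √α₁ * √α₂ / √α₃ = 0 := by
    field_simp
    rw [q1, q2, q3]
    linarith [hm.mul_eq]
  obtain ⟨rfl, rfl, rfl⟩ := hw.eq_of_eq_zero (solvesEvolution_exp s1 s2 s3 hsum)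
    (by simp [z1]) (by simp [z2]) (by simp [z3])
  refine ⟨by rw [Real.sqrt_mul (by positivity), Real.sqrt_mul hp1.le], _, _, _, rfl, rfl, rfl, ?_⟩
  rw [Real.sqrt_mul hp2.le, Real.sqrt_mul hp3.le, Real.sqrt_mul hp1.le]
  exact ⟨hsum, fun t => ⟨rfl, rfl, rfl⟩⟩

theorem caseC {A : ℝ} (hp : IsPolarForm w₁ w₂ w₃ α₁ α₂ α₃ u θ₁ θ₂ θ₃)
    (hw : SolvesEvolution w₁ w₂ w₃) (hu : u 0 ≤ 0) (h2 : θ₂ 0 = 0) (h3 : θ₃ 0 = 0)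
    (hle : α₂ ≤ α₃) (hA0 : 0 < A) (hA1 : A < √(α₁ * α₂ * α₃))
    (hA : ∀ t, (w₁ t * w₂ t * w₃ t).im = A) (hre : (w₁ 0 * w₂ 0 * w₃ 0).re = 0) :
    CaseC α₁ α₂ α₃ A u θ₁ θ₂ θ₃ := by
  have hm := hp.moduli
  have hp2 := hm.pos_two
  have hA2 : A ^ 2 < α₁ * α₂ * α₃ := (Real.lt_sqrt hA0.le).1 hA1
  have hroot : evolutionQ α₁ α₂ α₃ (u 0) = A ^ 2 := by rw [← hm.norm_sq_eq, hA, hre]; ring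
  obtain ⟨γ₂, γ₃, h0, h23, h2', hfac⟩ := exists_roots_evolutionQ hp2 hle hA0 hA2 hu hroot
  have hu0 : u 0 ≠ 0 := fun h => by
    rw [h] at hroot
    simp only [evolutionQ, add_zero, sub_zero] at hroot
    linarith
  have hlt : u 0 < γ₂ := (lt_of_le_of_ne hu hu0).trans_le h0
  have hsol := fun t => hm.eq_jacobiSn hw hre rfl hlt h23 hfac t
  -- A ≠ 0 keeps every wⱼ away from zero, so the phases are differentiable everywhere and the
  -- integrands are continuous.
  have hne : ∀ t, w₁ t * w₂ t * w₃ t ≠ 0 := fun t h => by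
    have := hA t
    rw [h, Complex.zero_im] at this
    exact hA0.ne this
  have r1 : ∀ t, 0 < α₁ + u t := fun t => by
    have := left_ne_zero_of_mul (left_ne_zero_of_mul (hne t))
    rw [← hm.norm_one]
    positivity
  have r2 : ∀ t, 0 < α₂ - u t := fun t => by
    have := right_ne_zero_of_mul (left_ne_zero_of_mul (hne t))
    rw [← hm.norm_two]
    positivity
  have r3 : ∀ t, 0 < α₃ - u t := fun t => by
    have := right_ne_zero_of_mul (hne t)
    rw [← hm.norm_three]
    positivity
  have huc : Continuous u := continuous_iff_continuousAt.2 fun t => (hm.hasDerivAt hw t).continuousAt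
  have hint : ∀ {θ r : ℝ → ℝ} {B : ℝ} (_ : ∀ t, HasDerivAt θ (B * (1 / r t)) t)
      (_ : Continuous r) (_ : ∀ t, 0 < r t) (t : ℝ),
      θ t = θ 0 + B * ∫ s in (0 : ℝ)..t, 1 / r s := fun {θ r B} hθ hr hpos t => by
    have hcont : Continuous fun t => 1 / r t := continuous_const.div hr fun t => (hpos t).ne'
    have := intervalIntegral.integral_eq_sub_of_hasDerivAt (a := 0) (b := t) (fun x _ => hθ x)
      ((continuous_const.mul hcont).intervalIntegrable _ _)
    rw [intervalIntegral.integral_const_mul] at this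
    linarith
  have d1 : ∀ t, HasDerivAt θ₁ (-A * (1 / (α₁ + u t))) t := fun t => by
    refine (hp.phase_one.hasDerivAt (hw.deriv_one t) (r1 t)).congr_deriv ?_
    rw [← map_mul, Complex.conj_im, ← mul_assoc, hA]
    ring
  have d2 : ∀ t, HasDerivAt θ₂ (A * (1 / (α₂ - u t))) t := fun t => by
    refine (hp.phase_two.hasDerivAt (hw.deriv_two t) (r2 t)).congr_deriv ?_
    rw [mul_neg, ← map_mul, Complex.neg_im, Complex.conj_im, neg_neg, ← hA t]
    ring_nf
  have d3 : ∀ t, HasDerivAt θ₃ (A * (1 / (α₃ - u t))) t := fun t => by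
    refine (hp.phase_three.hasDerivAt (hw.deriv_three t) (r3 t)).congr_deriv ?_
    rw [mul_neg, ← map_mul, Complex.neg_im, Complex.conj_im, neg_neg, ← hA t]
    ring_nf
  have i1 := hint d1 (by fun_prop) r1
  have i2 := hint d2 (by fun_prop) r2
  have i3 := hint d3 (by fun_prop) r3
  refine ⟨hA0, hA1, u 0, γ₂, γ₃, hu, h0, h23, hfac, _, _, rfl, rfl, fun t => ⟨hsol t, ?_, ?_, ?_⟩⟩
  · rw [i1 t, neg_mul, ← sub_eq_add_neg]
    simp only [add_assoc, ← hsol]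
  · rw [i2 t, h2, zero_add]
    simp only [sub_sub, ← hsol]
  · rw [i3 t, h3, zero_add]
    simp only [sub_sub, ← hsol]

end IsPolarForm

/-! ### Assembling the cases by the value of A -/

theorem theorem9p3 (w₁ w₂ w₃ : ℝ → ℂ) (hw : SolvesEvolution w₁ w₂ w₃)
    (hgen : ∃ t, w₁ t ≠ 0 ∧ w₂ t ≠ 0 ∧ w₃ t ≠ 0) :
    (∃! α : ℝ × ℝ × ℝ, ∃ u : ℝ → ℝ, IsModuli w₁ w₂ w₃ α.1 α.2.1 α.2.2 u) ∧
    ∀ (α₁ α₂ α₃ : ℝ) (u θ₁ θ₂ θ₃ : ℝ → ℝ), IsPolarForm w₁ w₂ w₃ α₁ α₂ α₃ u θ₁ θ₂ θ₃ →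
      ∃ A : ℝ,
        (∀ t, √(evolutionQ α₁ α₂ α₃ (u t)) * Real.sin (θ₁ t + θ₂ t + θ₃ t) = A) ∧
        (IsLocalMin u 0 → θ₂ 0 = 0 → θ₃ 0 = 0 → 0 ≤ A → α₂ ≤ α₃ →
          ∃! i : Fin 4, (![CaseA w₁ w₂ w₃ α₁ α₂ α₃ A,
            CaseB w₁ w₂ w₃ α₁ α₂ α₃ A,
            CaseC α₁ α₂ α₃ A u θ₁ θ₂ θ₃,
            CaseD w₁ w₂ w₃ α₁ α₂ α₃ A] : Fin 4 → Prop) i) := by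
  refine ⟨hw.existsUnique_isModuli hgen, fun α₁ α₂ α₃ u θ₁ θ₂ θ₃ hp =>
    ⟨(w₁ 0 * w₂ 0 * w₃ 0).im, fun t => by rw [hp.im_mul, hw.im_mul_eq t 0], ?_⟩⟩
  intro hmin h2 h3 hA hle
  have hm := hp.moduli
  have hp1 := hm.pos_one
  have hp2 := hm.pos_two
  have hp3 := hm.pos_three
  have hu := hm.nonpos_of_isLocalMin hw hgen hle hmin
  have hre := hm.re_eq_zero_of_isLocalMin hw hmin
  have hroot := hm.norm_sq_eq 0
  have him := fun t => hw.im_mul_eq t 0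
  rw [hre] at hroot
  have hu1 : 0 ≤ α₁ + u 0 := by rw [← hm.norm_one]; positivity
  have hspos : 0 < √(α₁ * α₂ * α₃) := Real.sqrt_pos.2 (by positivity)
  have hdiff : α₁ * α₂ * α₃ - evolutionQ α₁ α₂ α₃ (u 0) =
      u 0 ^ 2 * (α₂ + α₃ - α₁ - u 0) := by
    rw [evolutionQ]
    linear_combination u 0 * hm.mul_eq
  have h12 : α₁ < α₂ := by nlinarith [hm.mul_eq, mul_pos hp1 hp2]
  have hfac : 0 < α₂ + α₃ - α₁ - u 0 := by linarith
  have hexists : CaseA w₁ w₂ w₃ α₁ α₂ α₃ (w₁ 0 * w₂ 0 * w₃ 0).im ∨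
      CaseB w₁ w₂ w₃ α₁ α₂ α₃ (w₁ 0 * w₂ 0 * w₃ 0).im ∨
      CaseC α₁ α₂ α₃ (w₁ 0 * w₂ 0 * w₃ 0).im u θ₁ θ₂ θ₃ ∨
      CaseD w₁ w₂ w₃ α₁ α₂ α₃ (w₁ 0 * w₂ 0 * w₃ 0).im := by
    generalize (w₁ 0 * w₂ 0 * w₃ 0).im = A at *
    rcases hA.eq_or_lt with rfl | hA0
    · have hu' : u 0 = -α₁ := by
        -- Here Q(u(0)) = 0, and u(0) ≤ 0 leaves only its first factor free to vanish.
        have hpos : 0 < (α₂ - u 0) * (α₃ - u 0) := mul_pos (by linarith) (by linarith)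
        rw [evolutionQ, mul_assoc] at hroot
        have := (mul_eq_zero.1 (hroot.symm.trans (by norm_num))).resolve_right hpos.ne'
        linarith
      rcases hp.caseA_or_caseB hw hu' h2 h3 hle with h | h
      · exact Or.inl h
      · exact Or.inr (Or.inl h)
    · have hAle : A ≤ √(α₁ * α₂ * α₃) := Real.le_sqrt_of_sq_le (by
        nlinarith [mul_nonneg (sq_nonneg (u 0)) hfac.le])
      rcases hAle.eq_or_lt with heq | hlt
      · refine Or.inr (Or.inr (Or.inr ?_))
        have hsq : A ^ 2 = α₁ * α₂ * α₃ := by rw [heq, Real.sq_sqrt (by positivity)]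
        have hu' : u 0 = 0 := by
          have : u 0 ^ 2 * (α₂ + α₃ - α₁ - u 0) = 0 := by linarith
          exact pow_eq_zero_iff two_ne_zero |>.1 ((mul_eq_zero.1 this).resolve_right hfac.ne')
        have := hp.caseD hw hu' h2 h3 ((him 0).trans heq) hre
        rwa [← heq] at this
      · exact Or.inr (Or.inr (Or.inl (hp.caseC hw hu h2 h3 hle hA0 hlt him hre)))
  -- Exclusivity needs only the range of A in each case, and the comparison of α₂ with α₃ to
  -- separate (a) from (b).
  have nAB : CaseA w₁ w₂ w₃ α₁ α₂ α₃ (w₁ 0 * w₂ 0 * w₃ 0).im →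
      ¬CaseB w₁ w₂ w₃ α₁ α₂ α₃ (w₁ 0 * w₂ 0 * w₃ 0).im :=
    fun a b => b.2.1.ne a.2.1
  have zeroA : ∀ A, CaseA w₁ w₂ w₃ α₁ α₂ α₃ A → A = 0 := fun A a => a.1
  have zeroB : ∀ A, CaseB w₁ w₂ w₃ α₁ α₂ α₃ A → A = 0 := fun A a => a.1
  have boundsC : ∀ A, CaseC α₁ α₂ α₃ A u θ₁ θ₂ θ₃ → 0 < A ∧ A < √(α₁ * α₂ * α₃) :=
    fun A a => ⟨a.1, a.2.1⟩
  have valueD : ∀ A, CaseD w₁ w₂ w₃ α₁ α₂ α₃ A → A = √(α₁ * α₂ * α₃) := fun A a => a.1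
  generalize (w₁ 0 * w₂ 0 * w₃ 0).im = A at *
  rcases hexists with h | h | h | h
  · refine ⟨0, h, fun i hi => ?_⟩
    fin_cases i
    · rfl
    · exact (nAB h hi).elim
    · exact ((boundsC _ hi).1.ne' (zeroA _ h)).elim
    · exact (hspos.ne' ((valueD _ hi).symm.trans (zeroA _ h))).elim
  · refine ⟨1, h, fun i hi => ?_⟩
    fin_cases i
    · exact (nAB hi h).elim
    · rfl
    · exact ((boundsC _ hi).1.ne' (zeroB _ h)).elim
    · exact (hspos.ne' ((valueD _ hi).symm.trans (zeroB _ h))).elim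
  · refine ⟨2, h, fun i hi => ?_⟩
    fin_cases i
    · exact ((boundsC _ h).1.ne' (zeroA _ hi)).elim
    · exact ((boundsC _ h).1.ne' (zeroB _ hi)).elim
    · rfl
    · exact ((boundsC _ h).2.ne (valueD _ hi)).elim
  · refine ⟨3, h, fun i hi => ?_⟩
    fin_cases i
    · exact (hspos.ne' ((valueD _ h).symm.trans (zeroA _ hi))).elim
    · exact (hspos.ne' ((valueD _ h).symm.trans (zeroB _ hi))).elim
    · exact ((boundsC _ hi).2.ne (valueD _ h)).elim
    · rfl
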